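/- For a non-decreasing $g:[0,\infty)\to[0,\infty)$ with $g(0)=0$ and a real random variable $X$ put $\|X\|_g:=\inf\{\eta>0:\ \mathbb{E}[g(|X|/\eta)]\le 1\}\in[0,\infty]$. For $\alpha>0$ let $\psi_\alpha(x)=\exp(x^\alpha)-1$ $(x\ge 0)$; $X$ is sub-Weibull$(\alpha)$ if $\|X\|_{\psi_\alpha}<\infty$. For $\alpha>0$ and $L\ge 0$ let $\Psi_{\alpha,L}:[0,\infty)\to[0,\infty)$ be the function with inverse $\Psi_{\alpha,L}^{-1}(t)=\sqrt{\log(1+t)}+L(\log(1+t))^{1/\alpha}$, $t\ge 0$; $\|X\|_{\Psi_{\alpha,L}}$ is the Generalized Bernstein–Orlicz norm of $X$. **Theorem.** Let $0<\alpha\le 1$. There are constants $C_\alpha,K_\alpha>0$ depending only on $\alpha$ such that, for all $n$ and all independent mean-zero random variables $X_1,\dots,X_n$ with $\|X_i\|_{\psi_\alpha}<\infty$ for $1\le i\le n$, $$\Big\|\sum_{i=1}^n X_i\Big\|_{\Psi_{\alpha,L_n(\alpha)}}\le 2e\sqrt6\,\Big(\sum_{i=1}^n\mathbb{E}[X_i^2]\Big)^{1/2},$$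 where $$L_n(\alpha)=\frac{4^{1/\alpha}K_\alpha C_\alpha}{2\sqrt6}\,(\log(n+1))^{1/\alpha}\Big(\sum_{i=1}^n\mathbb{E}[X_i^2]\Big)^{-1/2}\max_{1\le i\le n}\|X_i\|_{\psi_\alpha}$$ (with $L_n(\alpha):=0$ in the degenerate case $\sum_{i=1}^n\mathbb{E}[X_i^2]=0$). -/

import Mathlib

open MeasureTheory ProbabilityTheory

noncomputable section

/-- The `g`-Orlicz norm `inf {η > 0 : E[g(|X|/η)] ≤ 1}` of a real random variable `X`, as an
extended nonnegative number (it is `∞` when no `η` qualifies). Only the values of `g` on `[0, ∞)`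
matter. The expectation of the nonnegative variable `g(|X|/η)` is a Lebesgue integral. -/
def orliczNorm {Ω : Type*} [MeasurableSpace Ω] (g : ℝ → ℝ) (X : Ω → ℝ) (μ : Measure Ω) :
    ENNReal :=
  ⨅ (η : ℝ) (_ : 0 < η) (_ : ∫⁻ ω, ENNReal.ofReal (g (|X ω| / η)) ∂μ ≤ 1), ENNReal.ofReal η

/-- `ψ_α(x) = exp(x^α) - 1` for `x ≥ 0`. -/
def psiWeibull (α x : ℝ) : ℝ := Real.exp (x ^ α) - 1

/-- A random variable is sub-Weibull of order `α` when its `ψ_α`-Orlicz norm is finite. -/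
def IsSubWeibull {Ω : Type*} [MeasurableSpace Ω] (α : ℝ) (X : Ω → ℝ) (μ : Measure Ω) : Prop :=
  orliczNorm (psiWeibull α) X μ < ⊤

/-- `Ψ_{α,L}⁻¹(t) = √(log(1+t)) + L (log(1+t))^{1/α}` for `t ≥ 0`. -/
def gboInv (α L t : ℝ) : ℝ :=
  Real.sqrt (Real.log (1 + t)) + L * Real.log (1 + t) ^ (1 / α)

/-- The function `Ψ_{α,L} : [0, ∞) → [0, ∞)`, the inverse of the bijection `gboInv α L` of
`[0, ∞)` (see `gbo_invOn`). -/
def gbo (α L : ℝ) : ℝ → ℝ := Function.invFunOn (gboInv α L) (Set.Ici 0)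

/-- The generalized Bernstein-Orlicz norm. -/
def gboNorm {Ω : Type*} [MeasurableSpace Ω] (α L : ℝ) (X : Ω → ℝ) (μ : Measure Ω) : ENNReal :=
  orliczNorm (gbo α L) X μ

/-- `gboInv α L` is a bijection of `[0, ∞)` onto itself. -/
theorem gboInv_bijOn {α L : ℝ} (hα : 0 < α) (hL : 0 ≤ L) :
    Set.BijOn (gboInv α L) (Set.Ici 0) (Set.Ici 0) := by
  have hlog : ∀ t ∈ Set.Ici (0 : ℝ), 0 ≤ Real.log (1 + t) := fun t ht =>
    Real.log_nonneg (by have : (0 : ℝ) ≤ t := ht; linarith)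
  have hmono : StrictMonoOn (gboInv α L) (Set.Ici 0) := by
    intro s hs t ht hst
    have hs' : (0 : ℝ) ≤ s := hs
    have h1 : Real.log (1 + s) < Real.log (1 + t) := Real.log_lt_log (by linarith) (by linarith)
    have h2 := Real.sqrt_lt_sqrt (hlog s hs) h1
    have h3 : Real.log (1 + s) ^ (1 / α) ≤ Real.log (1 + t) ^ (1 / α) :=
      Real.rpow_le_rpow (hlog s hs) h1.le (by positivity)
    exact add_lt_add_of_lt_of_le h2 (mul_le_mul_of_nonneg_left h3 hL)
  refine ⟨?_, hmono.injOn, ?_⟩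
  · intro t ht
    exact add_nonneg (Real.sqrt_nonneg _) (mul_nonneg hL (Real.rpow_nonneg (hlog t ht) _))
  · intro x hx
    have hx' : (0 : ℝ) ≤ x := hx
    have hb : (0 : ℝ) ≤ Real.exp (x ^ 2) - 1 := by
      have := Real.add_one_le_exp (x ^ 2); nlinarith [sq_nonneg x]
    have hc : ContinuousOn (gboInv α L) (Set.Icc 0 (Real.exp (x ^ 2) - 1)) := by
      have hl : ContinuousOn (fun t : ℝ => Real.log (1 + t))
          (Set.Icc 0 (Real.exp (x ^ 2) - 1)) := by
        apply ContinuousOn.log (by fun_prop)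
        intro t ht
        have := ht.1
        positivity
      exact hl.sqrt.add (continuousOn_const.mul
        (hl.rpow_const fun t _ => Or.inr (by positivity)))
    have h0 : gboInv α L 0 = 0 := by
      have h : (1 / α) ≠ 0 := by positivity
      simp only [gboInv, add_zero, Real.log_one, Real.sqrt_zero, Real.zero_rpow h, mul_zero]
    have h1 : x ≤ gboInv α L (Real.exp (x ^ 2) - 1) := by
      simp only [gboInv, add_sub_cancel, Real.log_exp, Real.sqrt_sq hx']
      have : 0 ≤ L * (x ^ 2) ^ (1 / α) := by positivity
      linarith
    obtain ⟨t, ht, rfl⟩ := intermediate_value_Icc hb hc ⟨h0.symm ▸ hx', h1⟩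
    exact ⟨t, ht.1, rfl⟩

/-- `gbo α L` is the two-sided inverse of `gboInv α L` on `[0, ∞)`. -/
theorem gbo_invOn {α L : ℝ} (hα : 0 < α) (hL : 0 ≤ L) :
    Set.InvOn (gbo α L) (gboInv α L) (Set.Ici 0) (Set.Ici 0) :=
  (gboInv_bijOn hα hL).invOn_invFunOn

end

/-!
Let `σ² = ∑ E[X_i²]`, let `M` be the largest `ψ_α`-norm, put `m = 2M` and `ℓ = log (n + 1)`. By the
layer cake formula (`gboNorm_le_of_tail`) it suffices to prove
`P(|∑ X_i| > 5 σ √u + B m ℓ^{1/α} u^{1/α}) ≤ 3 exp (-4u)` for `u ≥ 1/3` and a constant `B = B(α)`;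
this is `measure_abs_sum_gt_le`. The numerical constant `2e√6` leaves ample room: `5 ≤ 2e√6`.

Split each `X_i` at the level `(|X_i|/m)^α = 2ℓ`.

* The truncated variables are bounded by `τ = m (2ℓ)^{1/α}`, and Bernstein's inequality
  (`measure_sum_ge_le_of_abs_le`) gives the terms `5 σ √u + 4 τ u`. As `α ≤ 1`, the term `τ u` is
  at most a multiple of `m ℓ^{1/α} u^{1/α}`. The bias of each truncated variable is `O(m / (n + 1))`,
  so the total bias is `O(m)`.
* For the removed parts `Z_i`, the inequality `∑ |Z_i| ≤ (∑ |Z_i|^α)^{1/α}`, valid for `α ≤ 1`,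
  replaces the heavy-tailed sum by a sum of variables with exponential moments. Each of them
  vanishes unless `(|X_i|/m)^α > 2ℓ`, so its exponential moment at `1/2` is `1 + O(1 / (n + 1))`, and
  the product over `i` stays bounded (`measure_sum_weibullExcess_ge_le`). Hence `∑ |Z_i|` exceeds
  `m (4 + 8u)^{1/α}` with probability at most `exp (-4u)`.

No maximal inequality or hypercontractivity is needed. When all `X_i` vanish almost surely, both
sides of the inequality are zero.
-/

/-! ### Exponential moments of bounded variables -/

theorem exp_le_one_add_add_sq {x : ℝ} (hx : |x| ≤ 1) : Real.exp x ≤ 1 + x + x ^ 2 := by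
  have := (abs_le.1 (Real.abs_exp_sub_one_sub_id_le hx)).2
  linarith

theorem mgf_le_of_abs_le {Ω : Type*} [MeasurableSpace Ω] {μ : Measure Ω} [IsProbabilityMeasure μ]
    {Y : Ω → ℝ} {t τ : ℝ} (hY : Measurable Y) (hτ : ∀ ω, |Y ω| ≤ τ) (ht : 0 ≤ t)
    (htτ : t * τ ≤ 1) :
    mgf Y μ t ≤ Real.exp (t * ∫ ω, Y ω ∂μ + t ^ 2 * ∫ ω, Y ω ^ 2 ∂μ) := by
  have hi : Integrable Y μ :=
    Integrable.of_bound hY.aestronglyMeasurable τ (Filter.Eventually.of_forall hτ)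
  have hi2 : Integrable (fun ω => Y ω ^ 2) μ := by
    refine Integrable.of_bound (hY.pow_const 2).aestronglyMeasurable (τ ^ 2)
      (Filter.Eventually.of_forall fun ω => ?_)
    rw [Real.norm_eq_abs, abs_pow]
    exact pow_le_pow_left₀ (abs_nonneg _) (hτ ω) 2
  have hpt : ∀ ω, Real.exp (t * Y ω) ≤ 1 + t * Y ω + t ^ 2 * Y ω ^ 2 := fun ω => by
    rw [← mul_pow]
    refine exp_le_one_add_add_sq ?_
    rw [abs_mul, abs_of_nonneg ht]
    exact (mul_le_mul_of_nonneg_left (hτ ω) ht).trans htτ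
  have hi3 : Integrable (fun ω => 1 + t * Y ω) μ := (integrable_const _).add (hi.const_mul t)
  calc mgf Y μ t ≤ ∫ ω, (1 + t * Y ω + t ^ 2 * Y ω ^ 2) ∂μ :=
        integral_mono_of_nonneg (Filter.Eventually.of_forall fun ω => (Real.exp_pos _).le)
          (hi3.add (hi2.const_mul _)) (Filter.Eventually.of_forall hpt)
    _ = (t * ∫ ω, Y ω ∂μ + t ^ 2 * ∫ ω, Y ω ^ 2 ∂μ) + 1 := by
        rw [integral_add hi3 (hi2.const_mul _),
          integral_add (integrable_const _) (hi.const_mul t), integral_const_mul,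
          integral_const_mul]
        simp
        ring
    _ ≤ _ := Real.add_one_le_exp _

/-- Bernstein's inequality for uncentred summands bounded by `τ`, with `b` bounding the sum of the
means. Chernoff's bound is used at the exponent `t = min (√u / σ) (1 / τ)`. -/
theorem measure_sum_ge_le_of_abs_le {Ω ι : Type*} [Fintype ι] [MeasurableSpace Ω] {μ : Measure Ω}
    [IsProbabilityMeasure μ] {Y : ι → Ω → ℝ} {τ σ b u : ℝ} (hY : ∀ i, Measurable (Y i))
    (hind : iIndepFun Y μ) (hτ : ∀ i ω, |Y i ω| ≤ τ) (hτ0 : 0 < τ) (hσ : 0 < σ) (hu : 0 ≤ u)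
    (hb : ∑ i, ∫ ω, Y i ω ∂μ ≤ b) (hv : ∑ i, ∫ ω, Y i ω ^ 2 ∂μ ≤ σ ^ 2) :
    μ.real {ω | 5 * (σ * √u) + 4 * (τ * u) + b ≤ ∑ i, Y i ω} ≤ Real.exp (-(4 * u)) := by
  have key : ∀ t : ℝ, 0 ≤ t → t * τ ≤ 1 →
      μ.real {ω | 5 * (σ * √u) + 4 * (τ * u) + b ≤ ∑ i, Y i ω} ≤
        Real.exp (-t * (5 * (σ * √u) + 4 * (τ * u)) + t ^ 2 * σ ^ 2) := by
    intro t ht htτ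
    have hbound : ∀ ω, |∑ i, Y i ω| ≤ ∑ _i : ι, τ := fun ω =>
      (Finset.abs_sum_le_sum_abs _ _).trans (Finset.sum_le_sum fun i _ => hτ i ω)
    have hint : Integrable (fun ω => Real.exp (t * ∑ i, Y i ω)) μ := by
      refine Integrable.of_bound
        (Real.measurable_exp.comp ((Finset.measurable_sum _ fun i _ => hY i).const_mul t)
          |>.aestronglyMeasurable) (Real.exp (t * ∑ _i : ι, τ))
        (Filter.Eventually.of_forall fun ω => ?_)
      rw [Real.norm_eq_abs, Real.abs_exp]
      exact Real.exp_le_exp.2 (mul_le_mul_of_nonneg_left ((le_abs_self _).trans (hbound ω)) ht)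
    have hmgf : mgf (fun ω => ∑ i, Y i ω) μ t ≤ Real.exp (t * b + t ^ 2 * σ ^ 2) := by
      have h := hind.mgf_sum (t := t) hY Finset.univ
      have he : (∑ i, Y i) = fun ω => ∑ i, Y i ω := by
        ext ω; simp
      rw [he] at h
      rw [h]
      calc ∏ i, mgf (Y i) μ t
          ≤ ∏ i, Real.exp (t * ∫ ω, Y i ω ∂μ + t ^ 2 * ∫ ω, Y i ω ^ 2 ∂μ) :=
            Finset.prod_le_prod (fun i _ => mgf_nonneg)
              fun i _ => mgf_le_of_abs_le (hY i) (hτ i) ht htτ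
        _ = Real.exp (t * ∑ i, ∫ ω, Y i ω ∂μ + t ^ 2 * ∑ i, ∫ ω, Y i ω ^ 2 ∂μ) := by
            rw [← Real.exp_sum, Finset.sum_add_distrib, Finset.mul_sum, Finset.mul_sum]
        _ ≤ _ := by gcongr
    calc _ ≤ Real.exp (-t * (5 * (σ * √u) + 4 * (τ * u) + b)) * mgf (fun ω => ∑ i, Y i ω) μ t :=
          measure_ge_le_exp_mul_mgf _ ht hint
      _ ≤ Real.exp (-t * (5 * (σ * √u) + 4 * (τ * u) + b)) * Real.exp (t * b + t ^ 2 * σ ^ 2) := by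
          gcongr
      _ = _ := by rw [← Real.exp_add]; ring_nf
  have hsu : √u * √u = u := Real.mul_self_sqrt hu
  rcases le_total (√u * τ) σ with h | h
  · refine (key (√u / σ) (by positivity) ?_).trans (Real.exp_le_exp.2 ?_)
    · rw [div_mul_eq_mul_div, div_le_one hσ]; exact h
    · have h1 : √u / σ * (σ * √u) = u := by field_simp; linarith
      have h2 : (√u / σ) ^ 2 * σ ^ 2 = u := by field_simp; nlinarith
      have h3 : 0 ≤ √u / σ * (τ * u) := by positivity
      nlinarith
  · refine (key (1 / τ) (by positivity) (by field_simp; rfl)).trans (Real.exp_le_exp.2 ?_)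
    have h1 : 1 / τ * (τ * u) = u := by field_simp
    have h2 : (1 / τ) ^ 2 * σ ^ 2 ≤ 1 / τ * (σ * √u) := by
      have : σ * σ ≤ σ * (√u * τ) := mul_le_mul_of_nonneg_left h hσ.le
      rw [div_pow, one_pow, div_mul_eq_mul_div, div_mul_eq_mul_div, one_mul, one_mul,
        div_le_div_iff₀ (by positivity) hτ0]
      nlinarith
    have h3 : 0 ≤ 1 / τ * (σ * √u) := by positivity
    nlinarith

/-! ### Real inequalities and the layer cake bound -/

theorem sum_rpow_le_rpow_sum_of_one_le {ι : Type*} (s : Finset ι) {p : ℝ} (hp : 1 ≤ p) {a : ι → ℝ}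
    (ha : ∀ i ∈ s, 0 ≤ a i) : ∑ i ∈ s, a i ^ p ≤ (∑ i ∈ s, a i) ^ p := by
  have hp0 : (0 : ℝ) < p := by linarith
  have hsplit : ∀ x : ℝ, 0 ≤ x → x ^ p = x * x ^ (p - 1) := fun x hx => by
    conv_lhs => rw [show p = 1 + (p - 1) by ring]
    rw [Real.rpow_add' hx (by linarith), Real.rpow_one]
  have hs : 0 ≤ ∑ i ∈ s, a i := Finset.sum_nonneg ha
  rw [hsplit _ hs, Finset.sum_mul]
  refine Finset.sum_le_sum fun i hi => ?_
  rw [hsplit _ (ha i hi)]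
  exact mul_le_mul_of_nonneg_left (Real.rpow_le_rpow (ha i hi)
    (Finset.single_le_sum ha hi) (by linarith)) (ha i hi)

theorem le_mul_exp_rpow_half {α x : ℝ} (hα : 0 < α) (hx : 0 ≤ x) :
    x ≤ (2 / α) ^ (1 / α) * Real.exp (x ^ α / 2) := by
  have h1 : x ^ α ≤ 2 / α * Real.exp (x ^ α * α / 2) := by
    have := Real.add_one_le_exp (x ^ α * α / 2)
    rw [div_mul_eq_mul_div, le_div_iff₀ hα]
    linarith
  calc x = (x ^ α) ^ (1 / α) := by rw [← Real.rpow_mul hx, mul_one_div_cancel hα.ne', Real.rpow_one]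
    _ ≤ (2 / α * Real.exp (x ^ α * α / 2)) ^ (1 / α) := by gcongr
    _ = _ := by
      rw [Real.mul_rpow (by positivity) (Real.exp_pos _).le, ← Real.exp_mul]
      congr 2
      field_simp

/-- Layer cake formula: the probability is bounded by `1` below `s = 1/2`, and the rest contributes
`∫_{1/2}^∞ 3 (1 + s)⁻⁴ ds = (3/2)⁻³ = 8/27`, for a total of less than `1`. -/
theorem lintegral_ofReal_le_one_of_tail {Ω : Type*} [MeasurableSpace Ω] {μ : Measure Ω}
    [IsProbabilityMeasure μ] {f : Ω → ℝ} (hf : Measurable f) (hf0 : ∀ ω, 0 ≤ f ω)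
    (htail : ∀ s : ℝ, 1 / 2 ≤ s → μ.real {ω | s < f ω} ≤ 3 * ((1 + s) ^ 4)⁻¹) :
    ∫⁻ ω, ENNReal.ofReal (f ω) ∂μ ≤ 1 := by
  have hderiv : ∀ s ∈ Set.Ici (1 / 2 : ℝ),
      HasDerivAt (fun s : ℝ => -((1 + s) ^ 3)⁻¹) (3 * ((1 + s) ^ 4)⁻¹) s := by
    intro s hs
    have hs' : (1 / 2 : ℝ) ≤ s := hs
    have hne : (1 + s) ≠ 0 := by linarith
    have h1 := ((((hasDerivAt_id' s).const_add 1).fun_pow 3).fun_inv (pow_ne_zero 3 hne)).fun_neg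
    convert! h1 using 1
    field_simp
    norm_num
  have hlim : Filter.Tendsto (fun s : ℝ => -((1 + s) ^ 3)⁻¹) Filter.atTop (nhds 0) := by
    have h1 : Filter.Tendsto (fun s : ℝ => (1 + s) ^ 3) Filter.atTop Filter.atTop :=
      (Filter.tendsto_pow_atTop (by norm_num)).comp
        (Filter.tendsto_atTop_add_const_left _ 1 Filter.tendsto_id)
    simpa using h1.inv_tendsto_atTop.neg
  have hnn : ∀ s ∈ Set.Ioi (1 / 2 : ℝ), 0 ≤ 3 * ((1 + s) ^ 4)⁻¹ := fun s _ => by positivity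
  have hint := integrableOn_Ioi_deriv_of_nonneg' hderiv hnn hlim
  have hval := integral_Ioi_of_hasDerivAt_of_nonneg' hderiv hnn hlim
  have hlval : ∫⁻ s in Set.Ioi (1 / 2 : ℝ), ENNReal.ofReal (3 * ((1 + s) ^ 4)⁻¹) =
      ENNReal.ofReal (8 / 27) := by
    rw [← ofReal_integral_eq_lintegral_ofReal hint
      ((ae_restrict_iff' measurableSet_Ioi).2 (Filter.Eventually.of_forall hnn)), hval]
    norm_num
  rw [lintegral_eq_lintegral_meas_lt μ (Filter.Eventually.of_forall hf0) hf.aemeasurable,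
    ← Set.Ioc_union_Ioi_eq_Ioi (show (0 : ℝ) ≤ 1 / 2 by norm_num),
    lintegral_union measurableSet_Ioi (Set.Ioc_disjoint_Ioi le_rfl)]
  calc _ ≤ (∫⁻ _s in Set.Ioc (0 : ℝ) (1 / 2), 1) +
        ∫⁻ s in Set.Ioi (1 / 2 : ℝ), ENNReal.ofReal (3 * ((1 + s) ^ 4)⁻¹) := by
        refine add_le_add (lintegral_mono fun s => prob_le_one)
          (setLIntegral_mono' measurableSet_Ioi fun s hs => ?_)
        rw [← ENNReal.ofReal_toReal (measure_ne_top μ _)]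
        exact ENNReal.ofReal_le_ofReal (htail s (le_of_lt hs))
    _ = ENNReal.ofReal (1 / 2 + 8 / 27) := by
        rw [hlval, ENNReal.ofReal_add (by norm_num) (by norm_num)]
        simp
    _ ≤ 1 := ENNReal.ofReal_le_one.2 (by norm_num)

/-! ### Truncation of sub-Weibull variables -/

/-- The truncation `x · 1{(|x|/m)^α ≤ r}`; the level `r` is measured on the scale of the normalized
`α`-th power. -/
noncomputable def weibullTrunc (α m r x : ℝ) : ℝ := if (|x| / m) ^ α ≤ r then x else 0

/-- The large values `(|x|/m)^α · 1{(|x|/m)^α > r}` of the normalized `α`-th power. -/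
noncomputable def weibullExcess (α m r x : ℝ) : ℝ := if (|x| / m) ^ α ≤ r then 0 else (|x| / m) ^ α

theorem measurableSet_weibull_le (α m r : ℝ) : MeasurableSet {x : ℝ | (|x| / m) ^ α ≤ r} :=
  measurableSet_le (by fun_prop) measurable_const

theorem measurable_weibullTrunc (α m r : ℝ) : Measurable (weibullTrunc α m r) :=
  Measurable.ite (measurableSet_weibull_le α m r) measurable_id measurable_const

theorem measurable_weibullExcess (α m r : ℝ) : Measurable (weibullExcess α m r) :=
  Measurable.ite (measurableSet_weibull_le α m r) measurable_const (by fun_prop)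

theorem weibullExcess_nonneg {α m : ℝ} (r : ℝ) (hm : 0 < m) (x : ℝ) :
    0 ≤ weibullExcess α m r x := by
  unfold weibullExcess
  split_ifs
  · rfl
  · positivity

theorem abs_weibullTrunc_le {α m r : ℝ} (hα : 0 < α) (hm : 0 < m) (hr : 0 ≤ r) (x : ℝ) :
    |weibullTrunc α m r x| ≤ m * r ^ (1 / α) := by
  unfold weibullTrunc
  split_ifs with h
  · rw [← div_le_iff₀' hm]
    calc |x| / m = ((|x| / m) ^ α) ^ (1 / α) := by
          rw [← Real.rpow_mul (by positivity), mul_one_div_cancel hα.ne', Real.rpow_one]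
      _ ≤ r ^ (1 / α) := by gcongr
  · rw [abs_zero]; positivity

theorem weibullTrunc_sq_le (α m r x : ℝ) : weibullTrunc α m r x ^ 2 ≤ x ^ 2 := by
  unfold weibullTrunc
  split_ifs
  · rfl
  · rw [zero_pow two_ne_zero]; positivity

theorem abs_sub_weibullTrunc_eq {α m : ℝ} (r : ℝ) (hα : 0 < α) (hm : 0 < m) (x : ℝ) :
    |x - weibullTrunc α m r x| = m * weibullExcess α m r x ^ (1 / α) := by
  unfold weibullTrunc weibullExcess
  split_ifs
  · rw [sub_self, abs_zero, Real.zero_rpow (by positivity), mul_zero]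
  · rw [sub_zero, ← Real.rpow_mul (by positivity), mul_one_div_cancel hα.ne', Real.rpow_one]
    field_simp

theorem abs_le_weibull_mul_exp_half {α m : ℝ} (hα : 0 < α) (hm : 0 < m) (x : ℝ) :
    |x| ≤ m * ((2 / α) ^ (1 / α) * Real.exp ((|x| / m) ^ α / 2)) := by
  rw [← div_le_iff₀' hm]
  exact le_mul_exp_rpow_half hα (by positivity)

/-- On the event `(|x|/m)^α > r` half of the exponential moment pays for the factor
`exp (-r/2)`. -/
theorem abs_sub_weibullTrunc_le {α m : ℝ} (r : ℝ) (hα : 0 < α) (hm : 0 < m) (x : ℝ) :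
    |x - weibullTrunc α m r x| ≤
      m * (2 / α) ^ (1 / α) * Real.exp (-(r / 2)) * Real.exp ((|x| / m) ^ α) := by
  unfold weibullTrunc
  split_ifs with h
  · rw [sub_self, abs_zero]; positivity
  · rw [sub_zero, mul_assoc _ (Real.exp _), ← Real.exp_add, mul_assoc]
    refine (abs_le_weibull_mul_exp_half hα hm x).trans ?_
    gcongr
    linarith [not_le.1 h]

theorem exp_half_weibullExcess_le (α m r x : ℝ) :
    Real.exp (1 / 2 * weibullExcess α m r x) ≤
      1 + Real.exp (-(r / 2)) * Real.exp ((|x| / m) ^ α) := by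
  unfold weibullExcess
  split_ifs with h
  · rw [mul_zero, Real.exp_zero]
    have : 0 ≤ Real.exp (-(r / 2)) * Real.exp ((|x| / m) ^ α) := by positivity
    linarith
  · rw [← Real.exp_add]
    have : Real.exp (1 / 2 * (|x| / m) ^ α) ≤ Real.exp (-(r / 2) + (|x| / m) ^ α) :=
      Real.exp_le_exp.2 (by linarith [not_le.1 h])
    linarith

section Moments

variable {Ω : Type*} [MeasurableSpace Ω] {μ : Measure Ω} {α m : ℝ} {X : Ω → ℝ}

theorem sq_le_weibull_mul_exp (hα : 0 < α) (hm : 0 < m) (x : ℝ) :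
    x ^ 2 ≤ (m * (2 / α) ^ (1 / α)) ^ 2 * Real.exp ((|x| / m) ^ α) := by
  rw [← sq_abs]
  refine (pow_le_pow_left₀ (abs_nonneg _) (abs_le_weibull_mul_exp_half hα hm x) 2).trans
    (le_of_eq ?_)
  rw [← mul_assoc, mul_pow, ← Real.exp_nat_mul]
  congr 2
  push_cast
  ring

theorem integrable_sq_of_weibull (hα : 0 < α) (hm : 0 < m) (hX : Measurable X)
    (hi : Integrable (fun ω => Real.exp ((|X ω| / m) ^ α)) μ) :
    Integrable (fun ω => X ω ^ 2) μ := by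
  refine (hi.const_mul ((m * (2 / α) ^ (1 / α)) ^ 2)).mono' (hX.pow_const 2).aestronglyMeasurable
    (Filter.Eventually.of_forall fun ω => ?_)
  rw [Real.norm_eq_abs, abs_of_nonneg (sq_nonneg _)]
  exact sq_le_weibull_mul_exp hα hm (X ω)

theorem integral_sq_le_of_weibull (hα : 0 < α) (hm : 0 < m) (hX : Measurable X)
    (hi : Integrable (fun ω => Real.exp ((|X ω| / m) ^ α)) μ)
    (h2 : ∫ ω, Real.exp ((|X ω| / m) ^ α) ∂μ ≤ 2) :
    ∫ ω, X ω ^ 2 ∂μ ≤ (m * (2 / α) ^ (1 / α)) ^ 2 * 2 := by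
  refine (integral_mono (integrable_sq_of_weibull hα hm hX hi) (hi.const_mul _)
    fun ω => sq_le_weibull_mul_exp hα hm (X ω)).trans ?_
  rw [integral_const_mul]
  gcongr

/-- As `X` has mean zero, the bias of the truncated variable is the mean of the removed part. -/
theorem abs_integral_weibullTrunc_le [IsProbabilityMeasure μ] (r : ℝ) (hα : 0 < α) (hm : 0 < m)
    (hX : Measurable X) (h0 : ∫ ω, X ω ∂μ = 0)
    (hi : Integrable (fun ω => Real.exp ((|X ω| / m) ^ α)) μ)
    (h2 : ∫ ω, Real.exp ((|X ω| / m) ^ α) ∂μ ≤ 2) :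
    |∫ ω, weibullTrunc α m r (X ω) ∂μ| ≤
      m * (2 / α) ^ (1 / α) * Real.exp (-(r / 2)) * 2 := by
  have hXi : Integrable X μ :=
    ((memLp_two_iff_integrable_sq hX.aestronglyMeasurable).2
      (integrable_sq_of_weibull hα hm hX hi)).integrable (by norm_num)
  have hbd : Integrable (fun ω => m * (2 / α) ^ (1 / α) * Real.exp (-(r / 2)) *
      Real.exp ((|X ω| / m) ^ α)) μ := hi.const_mul _
  have hdi : Integrable (fun ω => X ω - weibullTrunc α m r (X ω)) μ :=
    hbd.mono' (hX.sub ((measurable_weibullTrunc α m r).comp hX)).aestronglyMeasurable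
      (Filter.Eventually.of_forall fun ω => abs_sub_weibullTrunc_le r hα hm (X ω))
  have hYi : Integrable (fun ω => weibullTrunc α m r (X ω)) μ := by
    exact (hXi.sub hdi).congr (Filter.Eventually.of_forall fun ω => by simp)
  have heq : ∫ ω, weibullTrunc α m r (X ω) ∂μ = -∫ ω, (X ω - weibullTrunc α m r (X ω)) ∂μ := by
    rw [integral_sub hXi hYi, h0]; ring
  rw [heq, abs_neg]
  calc _ ≤ ∫ ω, |X ω - weibullTrunc α m r (X ω)| ∂μ := abs_integral_le_integral_abs
    _ ≤ ∫ ω, m * (2 / α) ^ (1 / α) * Real.exp (-(r / 2)) * Real.exp ((|X ω| / m) ^ α) ∂μ :=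
        integral_mono hdi.abs hbd fun ω => abs_sub_weibullTrunc_le r hα hm (X ω)
    _ ≤ _ := by
        rw [integral_const_mul]
        gcongr

theorem integrable_exp_half_weibullExcess [IsProbabilityMeasure μ] (r : ℝ) (hX : Measurable X)
    (hi : Integrable (fun ω => Real.exp ((|X ω| / m) ^ α)) μ) :
    Integrable (fun ω => Real.exp (1 / 2 * weibullExcess α m r (X ω))) μ := by
  refine ((integrable_const 1).add (hi.const_mul (Real.exp (-(r / 2))))).mono'
    (Real.measurable_exp.comp
      (((measurable_weibullExcess α m r).comp hX).const_mul _)).aestronglyMeasurable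
    (Filter.Eventually.of_forall fun ω => ?_)
  rw [Real.norm_eq_abs, Real.abs_exp]
  exact exp_half_weibullExcess_le α m r (X ω)

theorem mgf_weibullExcess_le [IsProbabilityMeasure μ] (r : ℝ) (hX : Measurable X)
    (hi : Integrable (fun ω => Real.exp ((|X ω| / m) ^ α)) μ)
    (h2 : ∫ ω, Real.exp ((|X ω| / m) ^ α) ∂μ ≤ 2) :
    mgf (fun ω => weibullExcess α m r (X ω)) μ (1 / 2) ≤
      Real.exp (2 * Real.exp (-(r / 2))) := by
  calc _ ≤ ∫ ω, (1 + Real.exp (-(r / 2)) * Real.exp ((|X ω| / m) ^ α)) ∂μ :=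
        integral_mono (integrable_exp_half_weibullExcess r hX hi)
          ((integrable_const 1).add (hi.const_mul _))
          fun ω => exp_half_weibullExcess_le α m r (X ω)
    _ ≤ 2 * Real.exp (-(r / 2)) + 1 := by
        rw [integral_add (integrable_const 1) (hi.const_mul _), integral_const_mul]
        have := mul_le_mul_of_nonneg_left h2 (Real.exp_pos (-(r / 2))).le
        simp
        linarith
    _ ≤ _ := Real.add_one_le_exp _

end Moments

/-! ### The deviation inequality -/

/-- At the level `2 log (n + 1)` every excess has exponential moment at most `exp (2 / (n + 1))`, so
the sum of all `n` of them has exponential moment bounded by `exp 2`, uniformly in `n`. -/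
theorem measure_sum_weibullExcess_ge_le {Ω : Type*} [MeasurableSpace Ω] {μ : Measure Ω}
    [IsProbabilityMeasure μ] {α m : ℝ} {n : ℕ} {X : Fin n → Ω → ℝ} (hX : ∀ i, Measurable (X i))
    (hind : iIndepFun X μ) (hi : ∀ i, Integrable (fun ω => Real.exp ((|X i ω| / m) ^ α)) μ)
    (h2 : ∀ i, ∫ ω, Real.exp ((|X i ω| / m) ^ α) ∂μ ≤ 2) (u : ℝ) :
    μ.real {ω | 4 + 8 * u ≤ ∑ i, weibullExcess α m (2 * Real.log (n + 1)) (X i ω)} ≤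
      Real.exp (-(4 * u)) := by
  set r := 2 * Real.log ((n : ℝ) + 1) with hr
  have hind' : iIndepFun (fun i ω => weibullExcess α m r (X i ω)) μ :=
    hind.comp (fun _ => weibullExcess α m r) fun _ => measurable_weibullExcess α m r
  have hmeas : ∀ i, Measurable fun ω => weibullExcess α m r (X i ω) :=
    fun i => (measurable_weibullExcess α m r).comp (hX i)
  have he : (∑ i, fun ω => weibullExcess α m r (X i ω)) =
      fun ω => ∑ i, weibullExcess α m r (X i ω) := by
    ext ω; simp
  have hint : Integrable (fun ω => Real.exp (1 / 2 * ∑ i, weibullExcess α m r (X i ω))) μ := by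
    have := hind'.integrable_exp_mul_sum (t := 1 / 2) hmeas (s := Finset.univ)
      fun i _ => integrable_exp_half_weibullExcess r (hX i) (hi i)
    simpa using this
  have hexp : Real.exp (-(r / 2)) = ((n : ℝ) + 1)⁻¹ := by
    rw [hr, mul_div_cancel_left₀ _ two_ne_zero, Real.exp_neg, Real.exp_log (by positivity)]
  have hmgf : mgf (fun ω => ∑ i, weibullExcess α m r (X i ω)) μ (1 / 2) ≤ Real.exp 2 := by
    rw [← he, hind'.mgf_sum hmeas]
    calc _ ≤ ∏ _i : Fin n, Real.exp (2 * Real.exp (-(r / 2))) :=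
          Finset.prod_le_prod (fun i _ => mgf_nonneg)
            fun i _ => mgf_weibullExcess_le r (hX i) (hi i) (h2 i)
      _ ≤ _ := by
          rw [← Real.exp_sum, hexp]
          refine Real.exp_le_exp.2 ?_
          simp only [Finset.sum_const, Finset.card_univ, Fintype.card_fin, nsmul_eq_mul]
          rw [← mul_assoc, ← div_eq_mul_inv, div_le_iff₀ (by positivity)]
          linarith
  calc _ ≤ Real.exp (-(1 / 2) * (4 + 8 * u)) *
        mgf (fun ω => ∑ i, weibullExcess α m r (X i ω)) μ (1 / 2) :=
        measure_ge_le_exp_mul_mgf _ (by norm_num) hint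
    _ ≤ Real.exp (-(1 / 2) * (4 + 8 * u)) * Real.exp 2 := by gcongr
    _ = _ := by rw [← Real.exp_add]; ring_nf

/-- A constant depending only on `α` for the heavy-tailed term of the deviation inequality. -/
noncomputable def weibullConst (α : ℝ) : ℝ :=
  4 * 6 ^ (1 / α) + 2 * (2 / α) ^ (1 / α) * 6 ^ (1 / α) + 40 ^ (1 / α)

theorem weibullConst_pos {α : ℝ} (hα : 0 < α) : 0 < weibullConst α := by
  unfold weibullConst; positivity

theorem half_le_log_natCast_add_one {n : ℕ} (hn : n ≠ 0) : 1 / 2 ≤ Real.log ((n : ℝ) + 1) := by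
  have h1 : (1 : ℝ) ≤ n := by exact_mod_cast Nat.one_le_iff_ne_zero.2 hn
  have h2 : Real.log 2 ≤ Real.log ((n : ℝ) + 1) := Real.log_le_log (by norm_num) (by linarith)
  linarith [Real.log_two_gt_d9]

/-- The three scales produced by truncation (the range of the truncated variables, the bias of
the centering, the excess) are all absorbed in one Weibull term. -/
theorem weibull_scales_le {α ℓ u : ℝ} (hα0 : 0 < α) (hα1 : α ≤ 1) (hℓ : 1 / 2 ≤ ℓ)
    (hu : 1 / 3 ≤ u) :
    4 * ((2 * ℓ) ^ (1 / α) * u) + 2 * (2 / α) ^ (1 / α) + (4 + 8 * u) ^ (1 / α) ≤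
      weibullConst α * (ℓ ^ (1 / α) * u ^ (1 / α)) := by
  have hp : 1 ≤ 1 / α := by rwa [le_div_iff₀ hα0, one_mul]
  have hu0 : 0 ≤ u := by linarith
  have hℓ0 : 0 ≤ ℓ := by linarith
  have hℓu : 1 ≤ 6 * (ℓ * u) := by nlinarith
  have h1 : (2 * ℓ) ^ (1 / α) * u ≤ 6 ^ (1 / α) * (ℓ ^ (1 / α) * u ^ (1 / α)) := by
    have h3u : u ≤ (3 * u) ^ (1 / α) := by
      have := Real.rpow_le_rpow_of_exponent_le (x := 3 * u) (by linarith) hp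
      rw [Real.rpow_one] at this
      linarith
    calc _ ≤ (2 * ℓ) ^ (1 / α) * (3 * u) ^ (1 / α) := by gcongr
      _ = (6 * (ℓ * u)) ^ (1 / α) := by
        rw [← Real.mul_rpow (by positivity) (by positivity)]; ring_nf
      _ = _ := by
        rw [Real.mul_rpow (by norm_num) (by positivity), Real.mul_rpow hℓ0 hu0]
  have h2 : 1 ≤ 6 ^ (1 / α) * (ℓ ^ (1 / α) * u ^ (1 / α)) := by
    rw [← Real.mul_rpow hℓ0 hu0, ← Real.mul_rpow (by norm_num) (by positivity)]
    exact Real.one_le_rpow hℓu (by positivity)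
  have h3 : (4 + 8 * u) ^ (1 / α) ≤ 40 ^ (1 / α) * (ℓ ^ (1 / α) * u ^ (1 / α)) := by
    rw [← Real.mul_rpow hℓ0 hu0, ← Real.mul_rpow (by norm_num) (by positivity)]
    refine Real.rpow_le_rpow (by positivity) ?_ (by positivity)
    nlinarith
  have h2' := mul_le_mul_of_nonneg_left h2 (show 0 ≤ 2 * (2 / α) ^ (1 / α) by positivity)
  unfold weibullConst
  linarith

/-- Deviation inequality for a sum of independent centred sub-Weibull variables: outside three
events of probability at most `exp (-4u)` each (two for the sign of the truncated sum, one for the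
excess) the sum is bounded by a sub-Gaussian and a Weibull term. -/
theorem measure_abs_sum_gt_le {Ω : Type*} [MeasurableSpace Ω] {μ : Measure Ω}
    [IsProbabilityMeasure μ] {α m σ u : ℝ} {n : ℕ} {X : Fin n → Ω → ℝ} (hα0 : 0 < α) (hα1 : α ≤ 1)
    (hm : 0 < m) (hn : n ≠ 0) (hX : ∀ i, Measurable (X i)) (hind : iIndepFun X μ)
    (h0 : ∀ i, ∫ ω, X i ω ∂μ = 0)
    (hi : ∀ i, Integrable (fun ω => Real.exp ((|X i ω| / m) ^ α)) μ)
    (h2 : ∀ i, ∫ ω, Real.exp ((|X i ω| / m) ^ α) ∂μ ≤ 2) (hσ : 0 < σ)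
    (hv : ∑ i, ∫ ω, X i ω ^ 2 ∂μ ≤ σ ^ 2) (hu : 1 / 3 ≤ u) :
    μ.real {ω | 5 * (σ * √u) + m * (weibullConst α * (Real.log (n + 1) ^ (1 / α) * u ^ (1 / α)))
      < |∑ i, X i ω|} ≤ 3 * Real.exp (-(4 * u)) := by
  have hℓ := half_le_log_natCast_add_one hn
  have hdet := mul_le_mul_of_nonneg_left (weibull_scales_le hα0 hα1 hℓ hu) hm.le
  set ℓ := Real.log ((n : ℝ) + 1) with hℓdef
  set r := 2 * ℓ with hr
  set c := (2 / α) ^ (1 / α) with hc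
  set τ := m * r ^ (1 / α) with hτ
  have hr0 : 0 < r := by linarith
  have hτ0 : 0 < τ := by positivity
  have hexp : Real.exp (-(r / 2)) = ((n : ℝ) + 1)⁻¹ := by
    rw [hr, mul_div_cancel_left₀ _ two_ne_zero, Real.exp_neg, Real.exp_log (by positivity)]
  let Y : Fin n → Ω → ℝ := fun i ω => weibullTrunc α m r (X i ω)
  have hYm : ∀ i, Measurable (Y i) := fun i => (measurable_weibullTrunc α m r).comp (hX i)
  have hYτ : ∀ i ω, |Y i ω| ≤ τ := fun i ω => abs_weibullTrunc_le hα0 hm hr0.le _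
  have hYind : iIndepFun Y μ :=
    hind.comp (fun _ => weibullTrunc α m r) fun _ => measurable_weibullTrunc α m r
  have hYb : ∑ i, |∫ ω, Y i ω ∂μ| ≤ 2 * c * m := by
    calc _ ≤ ∑ _i : Fin n, m * c * Real.exp (-(r / 2)) * 2 := Finset.sum_le_sum fun i _ =>
          abs_integral_weibullTrunc_le r hα0 hm (hX i) (h0 i) (hi i) (h2 i)
      _ = 2 * c * m * (n / (n + 1)) := by
          rw [hexp]
          simp only [Finset.sum_const, Finset.card_univ, Fintype.card_fin, nsmul_eq_mul]
          ring
      _ ≤ 2 * c * m := by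
          refine mul_le_of_le_one_right (by positivity) ?_
          rw [div_le_one (by positivity)]
          linarith
  have hYv : ∑ i, ∫ ω, Y i ω ^ 2 ∂μ ≤ σ ^ 2 :=
    (Finset.sum_le_sum fun i _ => integral_mono_of_nonneg
      (Filter.Eventually.of_forall fun ω => sq_nonneg _)
      (integrable_sq_of_weibull hα0 hm (hX i) (hi i))
      (Filter.Eventually.of_forall fun ω => weibullTrunc_sq_le α m r (X i ω))).trans hv
  have hup := measure_sum_ge_le_of_abs_le hYm hYind hYτ hτ0 hσ (u := u) (by linarith)
    ((Finset.sum_le_sum fun i _ => le_abs_self _).trans hYb) hYv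
  have hlow := measure_sum_ge_le_of_abs_le (Y := fun i ω => -Y i ω) (μ := μ) (u := u)
    (b := 2 * c * m) (σ := σ) (fun i => (hYm i).neg)
    (hYind.comp (fun _ x => -x) fun _ => measurable_neg)
    (fun i ω => by rw [abs_neg]; exact hYτ i ω) hτ0 hσ (by linarith)
    ((Finset.sum_le_sum fun i _ => by
      rw [integral_neg]; exact neg_le_abs _).trans hYb) (by simpa using hYv)
  have hexc := measure_sum_weibullExcess_ge_le hX hind hi h2 u
  have hsub : {ω | 5 * (σ * √u) + m * (weibullConst α * (ℓ ^ (1 / α) * u ^ (1 / α)))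
      < |∑ i, X i ω|} ⊆
      ({ω | 5 * (σ * √u) + 4 * (τ * u) + 2 * c * m ≤ ∑ i, Y i ω} ∪
      {ω | 5 * (σ * √u) + 4 * (τ * u) + 2 * c * m ≤ ∑ i, -Y i ω}) ∪
      {ω | 4 + 8 * u ≤ ∑ i, weibullExcess α m r (X i ω)} := by
    intro ω hω
    by_contra hcon
    simp only [Set.mem_union, Set.mem_ofPred_eq, not_or, not_le, Finset.sum_neg_distrib] at hcon hω
    obtain ⟨⟨ha, hb⟩, hc'⟩ := hcon
    have hYabs : |∑ i, Y i ω| ≤ 5 * (σ * √u) + 4 * (τ * u) + 2 * c * m :=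
      abs_le.2 ⟨by linarith, ha.le⟩
    have hU0 : ∀ i ∈ Finset.univ, 0 ≤ weibullExcess α m r (X i ω) :=
      fun i _ => weibullExcess_nonneg r hm _
    have hZ : |∑ i, (X i ω - Y i ω)| ≤ m * (4 + 8 * u) ^ (1 / α) := by
      calc _ ≤ ∑ i, |X i ω - Y i ω| := Finset.abs_sum_le_sum_abs _ _
        _ = m * ∑ i, weibullExcess α m r (X i ω) ^ (1 / α) := by
            rw [Finset.mul_sum]
            exact Finset.sum_congr rfl fun i _ => abs_sub_weibullTrunc_eq r hα0 hm _
        _ ≤ m * (∑ i, weibullExcess α m r (X i ω)) ^ (1 / α) := by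
            refine mul_le_mul_of_nonneg_left (sum_rpow_le_rpow_sum_of_one_le _ ?_ hU0) hm.le
            rwa [le_div_iff₀ hα0, one_mul]
        _ ≤ _ := by
            have := Finset.sum_nonneg hU0
            gcongr
    have htri : |∑ i, X i ω| ≤ |∑ i, Y i ω| + |∑ i, (X i ω - Y i ω)| := by
      have : ∑ i, X i ω = ∑ i, Y i ω + ∑ i, (X i ω - Y i ω) := by
        rw [Finset.sum_sub_distrib]; ring
      rw [this]
      exact abs_add_le _ _
    have : τ * u = m * (r ^ (1 / α) * u) := by rw [hτ]; ring
    linarith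
  calc _ ≤ _ := measureReal_mono hsub
    _ ≤ _ := (measureReal_union_le _ _).trans (add_le_add_left (measureReal_union_le _ _) _)
    _ ≤ _ := by linarith

/-! ### Orlicz norms -/

theorem gboInv_strictMonoOn {α L : ℝ} (hα : 0 < α) (hL : 0 ≤ L) :
    StrictMonoOn (gboInv α L) (Set.Ici 0) := by
  intro s hs t _ hst
  have hs' : (0 : ℝ) ≤ s := hs
  have h0 : 0 ≤ Real.log (1 + s) := Real.log_nonneg (by linarith)
  have h1 : Real.log (1 + s) < Real.log (1 + t) := Real.log_lt_log (by linarith) (by linarith)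
  have h3 : Real.log (1 + s) ^ (1 / α) ≤ Real.log (1 + t) ^ (1 / α) :=
    Real.rpow_le_rpow h0 h1.le (by positivity)
  exact add_lt_add_of_lt_of_le (Real.sqrt_lt_sqrt h0 h1) (mul_le_mul_of_nonneg_left h3 hL)

theorem gbo_nonneg {α L x : ℝ} (hα : 0 < α) (hL : 0 ≤ L) (hx : 0 ≤ x) : 0 ≤ gbo α L x :=
  (gboInv_bijOn hα hL).surjOn.mapsTo_invFunOn hx

theorem lt_gbo_iff {α L s x : ℝ} (hα : 0 < α) (hL : 0 ≤ L) (hs : 0 ≤ s) (hx : 0 ≤ x) :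
    s < gbo α L x ↔ gboInv α L s < x := by
  have h := (gboInv_strictMonoOn hα hL).lt_iff_lt (Set.mem_Ici.2 hs)
    (Set.mem_Ici.2 (gbo_nonneg hα hL hx))
  rw [← h, (gbo_invOn hα hL).2 hx]

theorem gbo_monotoneOn {α L : ℝ} (hα : 0 < α) (hL : 0 ≤ L) :
    MonotoneOn (gbo α L) (Set.Ici 0) := by
  intro x hx y hy hxy
  rw [← (gboInv_strictMonoOn hα hL).le_iff_le (gbo_nonneg hα hL hx) (gbo_nonneg hα hL hy),
    (gbo_invOn hα hL).2 hx, (gbo_invOn hα hL).2 hy]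
  exact hxy

theorem gbo_zero {α L : ℝ} (hα : 0 < α) (hL : 0 ≤ L) : gbo α L 0 = 0 := by
  have h0 : gboInv α L 0 = 0 := by
    have h : (1 / α) ≠ 0 := by positivity
    simp only [gboInv, add_zero, Real.log_one, Real.sqrt_zero, Real.zero_rpow h, mul_zero]
  have := (gbo_invOn hα hL).1 (Set.mem_Ici.2 le_rfl)
  rwa [h0] at this

/-- Only the values of `gbo` on `[0, ∞)` are controlled, so the argument is clamped to that
half-line. -/
theorem measurable_gbo_comp {Ω : Type*} [MeasurableSpace Ω] {α L : ℝ} (hα : 0 < α) (hL : 0 ≤ L)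
    {f : Ω → ℝ} (hf : Measurable f) (hf0 : ∀ ω, 0 ≤ f ω) : Measurable fun ω => gbo α L (f ω) := by
  have hmono : Monotone fun x : ℝ => gbo α L (max x 0) := fun x y hxy =>
    gbo_monotoneOn hα hL (Set.mem_Ici.2 (le_max_right _ _)) (Set.mem_Ici.2 (le_max_right _ _))
       (max_le_max_right 0 hxy)
  have heq : (fun ω => gbo α L (f ω)) = (fun x : ℝ => gbo α L (max x 0)) ∘ f := by
    ext ω
    simp [max_eq_left (hf0 ω)]
  rw [heq]
  exact hmono.measurable.comp hf

theorem orliczNorm_le {Ω : Type*} [MeasurableSpace Ω] {μ : Measure Ω} {g : ℝ → ℝ} {X : Ω → ℝ}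
    {η : ℝ} (hη : 0 < η) (h : ∫⁻ ω, ENNReal.ofReal (g (|X ω| / η)) ∂μ ≤ 1) :
    orliczNorm g X μ ≤ ENNReal.ofReal η :=
  iInf_le_of_le η (iInf_le_of_le hη (iInf_le _ h))

/-- A tail bound in the variable `u = log (1 + s)` controls the generalized Bernstein-Orlicz norm.
The range `u ≥ 1/3` suffices because only the levels `s ≥ 1/2` need a nontrivial bound. -/
theorem gboNorm_le_of_tail {Ω : Type*} [MeasurableSpace Ω] {μ : Measure Ω}
    [IsProbabilityMeasure μ] {α L η : ℝ} {S : Ω → ℝ} (hα : 0 < α) (hL : 0 ≤ L) (hη : 0 < η)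
    (hS : Measurable S)
    (htail : ∀ u : ℝ, 1 / 3 ≤ u →
      μ.real {ω | η * (√u + L * u ^ (1 / α)) < |S ω|} ≤ 3 * Real.exp (-(4 * u))) :
    gboNorm α L S μ ≤ ENNReal.ofReal η := by
  have hx0 : ∀ ω, 0 ≤ |S ω| / η := fun ω => by positivity
  refine orliczNorm_le hη (lintegral_ofReal_le_one_of_tail
    (measurable_gbo_comp hα hL (by fun_prop) hx0) (fun ω => gbo_nonneg hα hL (hx0 ω))
    fun s hs => ?_)
  -- `1/3 ≤ log (3/2)` is `1 - 1/x ≤ log x` at `x = 3/2`.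
  have hu : 1 / 3 ≤ Real.log (1 + s) := by
    have h1 := Real.one_sub_inv_le_log_of_pos (show (0 : ℝ) < 3 / 2 by norm_num)
    have h2 : Real.log (3 / 2) ≤ Real.log (1 + s) := Real.log_le_log (by norm_num) (by linarith)
    norm_num at h1
    linarith
  have h := htail _ hu
  have he : Real.exp (-(4 * Real.log (1 + s))) = ((1 + s) ^ 4)⁻¹ := by
    rw [Real.exp_neg, show (4 : ℝ) * Real.log (1 + s) = ((4 : ℕ) : ℝ) * Real.log (1 + s) by
      norm_num, Real.exp_nat_mul, Real.exp_log (by linarith)]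
  rw [he] at h
  refine le_trans (measureReal_mono fun ω hω => ?_) h
  have hω' : s < gbo α L (|S ω| / η) := hω
  rw [lt_gbo_iff hα hL (by linarith) (hx0 ω), lt_div_iff₀' hη] at hω'
  exact hω'

theorem gboNorm_eq_zero_of_ae_eq_zero {Ω : Type*} [MeasurableSpace Ω] {μ : Measure Ω} {α L : ℝ}
    {S : Ω → ℝ} (hα : 0 < α) (hL : 0 ≤ L) (hS : ∀ᵐ ω ∂μ, S ω = 0) : gboNorm α L S μ = 0 := by
  refine le_antisymm (ENNReal.le_of_forall_pos_le_add fun ε hε _ => ?_) zero_le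
  rw [zero_add, ← ENNReal.ofReal_coe_nnreal]
  refine orliczNorm_le (NNReal.coe_pos.2 hε) ?_
  have h0 : (fun ω => ENNReal.ofReal (gbo α L (|S ω| / ε))) =ᵐ[μ] fun _ => 0 := by
    filter_upwards [hS] with ω hω
    rw [hω, abs_zero, zero_div, gbo_zero hα hL, ENNReal.ofReal_zero]
  rw [lintegral_congr_ae h0]
  simp

/-- The infimum defining the norm need not be handled at its limit point: any `m` above the norm
dominates an admissible `η`. -/
theorem integrable_exp_of_orliczNorm_lt {Ω : Type*} [MeasurableSpace Ω] {μ : Measure Ω}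
    [IsProbabilityMeasure μ] {α m : ℝ} {X : Ω → ℝ} (hα : 0 < α) (hX : Measurable X)
    (h : orliczNorm (psiWeibull α) X μ < ENNReal.ofReal m) :
    Integrable (fun ω => Real.exp ((|X ω| / m) ^ α)) μ ∧
      ∫ ω, Real.exp ((|X ω| / m) ^ α) ∂μ ≤ 2 := by
  unfold orliczNorm at h
  simp only [iInf_lt_iff] at h
  obtain ⟨η, hη, hint, hlt⟩ := h
  have hηm : η < m := (ENNReal.ofReal_lt_ofReal_iff_of_nonneg hη.le).1 hlt
  have hpsi : ∀ ω, 0 ≤ psiWeibull α (|X ω| / m) := fun ω => by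
    have : 0 ≤ (|X ω| / m) ^ α := Real.rpow_nonneg (by have := hη.trans hηm; positivity) _
    have := Real.add_one_le_exp ((|X ω| / m) ^ α)
    unfold psiWeibull
    linarith
  have hmeas : Measurable fun ω => psiWeibull α (|X ω| / m) := by
    unfold psiWeibull
    fun_prop
  have hle : ∫⁻ ω, ENNReal.ofReal (psiWeibull α (|X ω| / m)) ∂μ ≤ 1 := by
    refine (lintegral_mono fun ω => ENNReal.ofReal_le_ofReal ?_).trans hint
    have hm := hη.trans hηm
    unfold psiWeibull
    gcongr
  have hi : Integrable (fun ω => psiWeibull α (|X ω| / m)) μ := by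
    refine ⟨hmeas.aestronglyMeasurable, ?_⟩
    rw [hasFiniteIntegral_iff_ofReal (Filter.Eventually.of_forall hpsi)]
    exact hle.trans_lt ENNReal.one_lt_top
  have hval : ∫ ω, psiWeibull α (|X ω| / m) ∂μ ≤ 1 := by
    rw [integral_eq_lintegral_of_nonneg_ae (Filter.Eventually.of_forall hpsi)
      hmeas.aestronglyMeasurable]
    exact ENNReal.toReal_le_of_le_ofReal zero_le_one (by simpa using hle)
  have heq : (fun ω => Real.exp ((|X ω| / m) ^ α)) =
      fun ω => psiWeibull α (|X ω| / m) + 1 := by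
    ext ω
    simp [psiWeibull]
  rw [heq]
  refine ⟨hi.add (integrable_const 1), ?_⟩
  rw [integral_add hi (integrable_const 1)]
  simp
  linarith

theorem ae_eq_zero_of_integral_sq_eq_zero {Ω : Type*} [MeasurableSpace Ω] {μ : Measure Ω}
    {X : Ω → ℝ} (hi : Integrable (fun ω => X ω ^ 2) μ) (h : ∫ ω, X ω ^ 2 ∂μ = 0) :
    ∀ᵐ ω ∂μ, X ω = 0 := by
  filter_upwards [(integral_eq_zero_iff_of_nonneg (fun ω => sq_nonneg (X ω)) hi).1 h] with ω hω
  simpa using hω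

theorem ae_eq_zero_of_orliczNorm_psiWeibull_eq_zero {Ω : Type*} [MeasurableSpace Ω]
    {μ : Measure Ω} [IsProbabilityMeasure μ] {α : ℝ} {X : Ω → ℝ} (hα : 0 < α)
    (hX : Measurable X) (h : orliczNorm (psiWeibull α) X μ = 0) : ∀ᵐ ω ∂μ, X ω = 0 := by
  have hexp : ∀ m : ℝ, 0 < m → Integrable (fun ω => Real.exp ((|X ω| / m) ^ α)) μ ∧
      ∫ ω, Real.exp ((|X ω| / m) ^ α) ∂μ ≤ 2 := fun m hm =>
    integrable_exp_of_orliczNorm_lt hα hX (by rw [h]; exact ENNReal.ofReal_pos.2 hm)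
  have hi := integrable_sq_of_weibull hα one_pos hX (hexp 1 one_pos).1
  refine ae_eq_zero_of_integral_sq_eq_zero hi ?_
  by_contra hV
  set V := ∫ ω, X ω ^ 2 ∂μ with hVdef
  have hVpos : 0 < V := (integral_nonneg fun ω => sq_nonneg (X ω)).lt_of_ne (Ne.symm hV)
  set c := (2 / α) ^ (1 / α) with hc
  have hc0 : 0 < c := by positivity
  -- With `m c = √V / 2` the second moment bound reads `V ≤ V / 2`.
  obtain ⟨h1, h2⟩ := hexp (√V / 2 / c) (by positivity)
  have hle := integral_sq_le_of_weibull hα (by positivity) hX h1 h2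
  rw [← hc, div_mul_cancel₀ _ hc0.ne', div_pow, Real.sq_sqrt hVpos.le] at hle
  linarith

/-! ### The norm of the sum -/

theorem mainTheorem2 (α : ℝ) (hα0 : 0 < α) (hα1 : α ≤ 1) :
    ∃ K C : ℝ, 0 < K ∧ 0 < C ∧
      ∀ {Ω : Type*} [MeasurableSpace Ω] (μ : Measure Ω) [IsProbabilityMeasure μ]
        (n : ℕ) (X : Fin n → Ω → ℝ),
        (∀ i, Measurable (X i)) →
        iIndepFun X μ →
        (∀ i, ∫ ω, X i ω ∂μ = 0) →
        (∀ i, IsSubWeibull α (X i) μ) →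
        gboNorm α
            ((4 : ℝ) ^ (1 / α) * K * C / (2 * Real.sqrt 6)
              * Real.log ((n : ℝ) + 1) ^ (1 / α)
              * (Real.sqrt (∑ i, ∫ ω, X i ω ^ 2 ∂μ))⁻¹
              * ⨆ i, (orliczNorm (psiWeibull α) (X i) μ).toReal)
            (fun ω => ∑ i, X i ω) μ
          ≤ ENNReal.ofReal
              (2 * Real.exp 1 * Real.sqrt 6 * Real.sqrt (∑ i, ∫ ω, X i ω ^ 2 ∂μ)) := by
  refine ⟨2 * weibullConst α, 1, by have := weibullConst_pos hα0; positivity, one_pos, ?_⟩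
  intro Ω _ μ _ n X hX hind h0 hsub
  have hB := weibullConst_pos hα0
  set M := ⨆ i, (orliczNorm (psiWeibull α) (X i) μ).toReal with hM
  set σ := √(∑ i, ∫ ω, X i ω ^ 2 ∂μ) with hσ
  have hM0 : 0 ≤ M := Real.iSup_nonneg fun i => ENNReal.toReal_nonneg
  have hV0 : ∀ i, 0 ≤ ∫ ω, X i ω ^ 2 ∂μ := fun i => integral_nonneg fun ω => sq_nonneg _
  have hlog : 0 ≤ Real.log ((n : ℝ) + 1) := Real.log_nonneg (by linarith [n.cast_nonneg (α := ℝ)])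
  have hL : 0 ≤ (4 : ℝ) ^ (1 / α) * (2 * weibullConst α) * 1 / (2 * √6) *
      Real.log ((n : ℝ) + 1) ^ (1 / α) * σ⁻¹ * M := by positivity
  have hnorm : ∀ m, M < m → ∀ i, orliczNorm (psiWeibull α) (X i) μ < ENNReal.ofReal m := by
    intro m hm i
    rw [← ENNReal.ofReal_toReal (hsub i).ne, ENNReal.ofReal_lt_ofReal_iff (hM0.trans_lt hm)]
    exact (le_ciSup (f := fun i => (orliczNorm (psiWeibull α) (X i) μ).toReal)
      (Set.finite_range _).bddAbove i).trans_lt hm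
  have hsq : ∀ i, Integrable (fun ω => X i ω ^ 2) μ := fun i =>
    integrable_sq_of_weibull hα0 (by linarith) (hX i)
      (integrable_exp_of_orliczNorm_lt hα0 (hX i) (hnorm (M + 1) (by linarith) i)).1
  by_cases hzero : ∀ i, ∀ᵐ ω ∂μ, X i ω = 0
  · rw [gboNorm_eq_zero_of_ae_eq_zero hα0 hL]
    · exact zero_le
    · filter_upwards [ae_all_iff.2 hzero] with ω hω
      exact Finset.sum_eq_zero fun i _ => hω i
  obtain ⟨j, hj⟩ := not_forall.1 hzero
  have hn : n ≠ 0 := by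
    rintro rfl
    exact j.elim0
  have hMpos : 0 < M := by
    refine hM0.lt_of_ne fun hM' => hj (ae_eq_zero_of_orliczNorm_psiWeibull_eq_zero hα0 (hX j) ?_)
    refine le_antisymm (ENNReal.le_of_forall_pos_le_add fun ε hε _ => ?_) zero_le
    rw [zero_add, ← ENNReal.ofReal_coe_nnreal]
    exact (hnorm ε (hM' ▸ NNReal.coe_pos.2 hε) j).le
  have hσpos : 0 < σ := by
    refine Real.sqrt_pos.2 ((Finset.sum_nonneg fun i _ => hV0 i).lt_of_ne fun hs => hj ?_)
    have hj0 := (Finset.sum_eq_zero_iff_of_nonneg fun i _ => hV0 i).1 hs.symm j (Finset.mem_univ j)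
    exact ae_eq_zero_of_integral_sq_eq_zero (hsq j) hj0
  -- Any scale strictly above `M` is admissible; the factor `2` here is the one in `K`.
  have hm := fun i => integrable_exp_of_orliczNorm_lt hα0 (hX i) (hnorm (2 * M) (by linarith) i)
  have h6 : 2 ≤ √6 := Real.le_sqrt_of_sq_le (by norm_num)
  have he : 2 ≤ Real.exp 1 := by linarith [Real.add_one_le_exp (1 : ℝ)]
  refine gboNorm_le_of_tail hα0 hL (by positivity)
    (Finset.measurable_sum _ fun i _ => hX i) fun u hu => ?_
  refine (measureReal_mono fun ω hω => ?_).trans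
    (measure_abs_sum_gt_le hα0 hα1 (by linarith) hn hX hind h0 (fun i => (hm i).1)
      (fun i => (hm i).2) hσpos (Real.sq_sqrt (Finset.sum_nonneg fun i _ => hV0 i)).ge hu)
  simp only [Set.mem_ofPred_eq] at hω ⊢
  refine lt_of_le_of_lt ?_ hω
  have hu0 : 0 ≤ u := by linarith
  rw [mul_add]
  refine add_le_add ?_ ?_
  · have h5 : 5 ≤ 2 * Real.exp 1 * √6 := by nlinarith
    have := mul_le_mul_of_nonneg_right h5 (show 0 ≤ σ * √u by positivity)
    linarith
  · have h4 : 1 ≤ Real.exp 1 * (4 : ℝ) ^ (1 / α) := by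
      have := Real.one_le_rpow (show (1 : ℝ) ≤ 4 by norm_num) (show 0 ≤ 1 / α by positivity)
      nlinarith
    have := mul_le_mul_of_nonneg_right h4 (show 0 ≤ 2 * M * (weibullConst α *
      (Real.log (n + 1) ^ (1 / α) * u ^ (1 / α))) by positivity)
    rw [one_mul] at this
    refine this.trans (le_of_eq ?_)
    field_simp
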